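/- Let $P$ be the uniform probability distribution on the segment $[0,2]\times\{0\}\subset\mathbb R^2$, i.e. the base $OA$ of the equilateral triangle with vertices $O=(0,0)$, $A=(2,0)$, $B=(1,\sqrt3)$, and let $S$ be the union of the other two sides, $S=\{(x,\sqrt3\,x):0\le x\le1\}\cup\{(x,-\sqrt3\,(x-2)):1\le x\le2\}$. For a nonempty finite set $\alpha\subset\mathbb R^2$ put $$V(P;\alpha)=\int\min_{a\in\alpha}\|x-a\|^2\,dP(x),$$ and for $n\ge1$ let $V_n=\inf\{V(P;\alpha):\alpha\subseteq S,\ 1\le\operatorname{card}(\alpha)\le n\}$ be the $n$th constrained quantization error of $P$ with respect to $S$. A set $\alpha\subseteq S$ with $1\le\operatorname{card}(\alpha)\le n$ and $V(P;\alpha)=V_n$ is called an optimal set of $n$-points. For positive integers $\ell,m$ let $$\alpha_{\ell,m}=\{(a_i,a_i\sqrt3):1\le i\le\ell\}\cup\{(b_j,-(b_j-2)\sqrt3):1\le j\le m\},\qquad a_i=\frac{(2i-1)u}2,\quad b_j=2-\frac{(2j-1)v}2,$$ where $$u=\frac{1}{2\left(\frac{(12\ell^2+1)m}{\sqrt{(12\ell^2+1)(12m^2+1)}}+\ell\right)},\qquad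 v=\frac{1}{2\left(\frac{\ell(12m^2+1)}{\sqrt{(12\ell^2+1)(12m^2+1)}}+m\right)}.$$ Let $n=2k$ with an integer $k\ge3$. Then $\alpha_{k,k}$ is an optimal set of $n$-points, and $$V_n=\frac1{48}\left(12+\frac1{k^2}\right).$$ -/

import Mathlib

open MeasureTheory

noncomputable section

namespace ConstrainedQuantization

/-- The Euclidean plane, with the metric of the Euclidean norm. -/
abbrev Plane : Type := EuclideanSpace ℝ (Fin 2)

/-- The distortion error `V(P; α) = ∫ min_{a ∈ α} d(x, a)² dP(x)`. It is only used for finite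
nonempty sets `α`, for which the infimum is a minimum, and for measures with a finite second
moment, for which the integrand is integrable. -/
def distortion (P : Measure Plane) (α : Set Plane) : ℝ :=
  ∫ x, ⨅ a : α, dist x (a : Plane) ^ 2 ∂P

/-- The sets competing for the `n`th constrained quantization error under the constraint `S`:
`α ⊆ S` with `1 ≤ card α ≤ n`. -/
def IsAdmissible (S : Set Plane) (n : ℕ) (α : Set Plane) : Prop :=
  α ⊆ S ∧ 1 ≤ α.encard ∧ α.encard ≤ n

/-- The `n`th constrained quantization error `V_n(P)` for the constraint `S`. -/
def quantizationError (P : Measure Plane) (S : Set Plane) (n : ℕ) : ℝ :=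
  sInf {r : ℝ | ∃ α : Set Plane, IsAdmissible S n α ∧ r = distortion P α}

/-- An optimal set of `n`-points: an admissible set that attains the infimum `V_n(P)`. -/
def IsOptimalSet (P : Measure Plane) (S : Set Plane) (n : ℕ) (α : Set Plane) : Prop :=
  IsAdmissible S n α ∧ distortion P α = quantizationError P S n

/-- The uniform distribution on the base `[0, 2] × {0}` of the triangle: the uniform probability
measure on the interval `[0, 2]`, carried to the plane by `x ↦ (x, 0)`. -/
def uniformBase : Measure Plane :=
  (ProbabilityTheory.cond (volume : Measure ℝ) (Set.Icc 0 2)).map fun x : ℝ => (!₂[x, 0] : Plane)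

/-- The side `OB` of the equilateral triangle with vertices `O(0, 0)`, `A(2, 0)`, `B(1, √3)`. -/
def sideLeft : Set Plane :=
  {p | 0 ≤ p 0 ∧ p 0 ≤ 1 ∧ p 1 = √3 * p 0}

/-- The side `AB` of the same triangle. -/
def sideRight : Set Plane :=
  {p | 1 ≤ p 0 ∧ p 0 ≤ 2 ∧ p 1 = -√3 * (p 0 - 2)}

/-- The constraint: the union of the two sides other than the base. -/
def sides : Set Plane := sideLeft ∪ sideRight

/-- The spacing parameter `u` of the points on the left side. -/
def spacingLeft (l m : ℕ) : ℝ :=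
  1 / (2 * ((12 * (l : ℝ) ^ 2 + 1) * m / √((12 * (l : ℝ) ^ 2 + 1) * (12 * (m : ℝ) ^ 2 + 1)) + l))

/-- The spacing parameter `v` of the points on the right side. -/
def spacingRight (l m : ℕ) : ℝ :=
  1 / (2 * (l * (12 * (m : ℝ) ^ 2 + 1) / √((12 * (l : ℝ) ^ 2 + 1) * (12 * (m : ℝ) ^ 2 + 1)) + m))

/-- `a_i = (2i - 1)u / 2`. -/
def leftAbscissa (l m i : ℕ) : ℝ := (2 * (i : ℝ) - 1) * spacingLeft l m / 2

/-- `b_j = 2 - (2j - 1)v / 2`. -/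
def rightAbscissa (l m j : ℕ) : ℝ := 2 - (2 * (j : ℝ) - 1) * spacingRight l m / 2

/-- The configuration `{(a_i, a_i √3) : 1 ≤ i ≤ l} ∪ {(b_j, -(b_j - 2)√3) : 1 ≤ j ≤ m}`. -/
def configuration (l m : ℕ) : Set Plane :=
  {p | ∃ i : ℕ, 1 ≤ i ∧ i ≤ l ∧ p = !₂[leftAbscissa l m i, leftAbscissa l m i * √3]} ∪
  {p | ∃ j : ℕ, 1 ≤ j ∧ j ≤ m ∧ p = !₂[rightAbscissa l m j, -(rightAbscissa l m j - 2) * √3]}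

end ConstrainedQuantization

end

open MeasureTheory

namespace ConstrainedQuantization

/-! Completing the square, the squared distance from `(x, 0)` to a point of either side is 3/4 of
the squared distance from `x` to that side's end of the base, plus 1/4 of `(x - c) ^ 2` for some `c`
determined by the point. Replacing the first term by its minimum over the two sides, independent of
the point, leaves one-dimensional quantization of `[0, 2]` by the numbers `c`. The bound
`le_distortion` handles this with truncated parabolas. It is attained because the `c` of the
configuration are the midpoints of `2k` equal cells, each served from its own side
(`exists_mem_configuration`). -/

/-- The point `(x, 0)` of the line through the base. -/
def basePoint (x : ℝ) : Plane := !₂[x, 0]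

/-! ### Distortion as an integral over `[0, 2]`. -/

lemma dist_basePoint_sq (x : ℝ) (p : Plane) :
    dist (basePoint x) p ^ 2 = (x - p 0) ^ 2 + p 1 ^ 2 := by
  rw [EuclideanSpace.dist_eq, Real.sq_sqrt (by positivity)]
  simp [basePoint, Fin.sum_univ_two, Real.dist_eq, sq_abs]

lemma continuous_basePoint : Continuous basePoint := by
  unfold basePoint
  fun_prop

/-- The squared distance from `p` to the nearest element of a finite set is continuous in `p`. -/
lemma continuous_iInf_dist_sq {α : Set Plane} (hfin : α.Finite) (hne : α.Nonempty) :
    Continuous fun p : Plane => ⨅ a : α, dist p (a : Plane) ^ 2 := by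
  have := hfin.fintype
  have := hne.to_subtype
  have h : (fun p : Plane => ⨅ a : α, dist p (a : Plane) ^ 2) =
      fun p => Finset.univ.inf' Finset.univ_nonempty fun a : α => dist p (a : Plane) ^ 2 := by
    funext p
    rw [Finset.inf'_univ_eq_ciInf]
  rw [h]
  exact Continuous.finset_inf'_apply _ fun a _ => by fun_prop

lemma distortion_uniformBase {α : Set Plane} (hfin : α.Finite) (hne : α.Nonempty) :
    distortion uniformBase α =
      1 / 2 * ∫ x in (0 : ℝ)..2, ⨅ a : α, dist (basePoint x) (a : Plane) ^ 2 := by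
  have hc := continuous_iInf_dist_sq hfin hne
  change ∫ x, _ ∂(Measure.map basePoint _) = _
  rw [integral_map continuous_basePoint.aemeasurable hc.aestronglyMeasurable,
    ProbabilityTheory.cond, integral_smul_measure, intervalIntegral.integral_of_le (by norm_num),
    integral_Icc_eq_integral_Ioc]
  simp

/-! ### Splitting the squared distance. -/

/-- The distance from `x` to the nearer endpoint of `[0, 2]`. -/
def edgeDist (x : ℝ) : ℝ := min x (2 - x)

lemma continuous_edgeDist : Continuous edgeDist := by
  unfold edgeDist
  fun_prop

lemma integral_edgeDist_sq : ∫ x in (0 : ℝ)..2, edgeDist x ^ 2 = 2 / 3 := by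
  have hi (a b : ℝ) : IntervalIntegrable (fun x => edgeDist x ^ 2) volume a b :=
    (continuous_edgeDist.pow 2).intervalIntegrable a b
  rw [← intervalIntegral.integral_add_adjacent_intervals (hi 0 1) (hi 1 2)]
  have h1 : ∫ x in (0 : ℝ)..1, edgeDist x ^ 2 = ∫ x in (0 : ℝ)..1, x ^ 2 := by
    refine intervalIntegral.integral_congr fun x hx => ?_
    rw [Set.uIcc_of_le (by norm_num)] at hx
    simp only [edgeDist]
    rw [min_eq_left (by linarith [hx.2])]
  have h2 : ∫ x in (1 : ℝ)..2, edgeDist x ^ 2 = ∫ x in (1 : ℝ)..2, (2 - x) ^ 2 := by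
    refine intervalIntegral.integral_congr fun x hx => ?_
    rw [Set.uIcc_of_le (by norm_num)] at hx
    simp only [edgeDist]
    rw [min_eq_right (by linarith [hx.1])]
  rw [h1, h2, intervalIntegral.integral_comp_sub_left (fun x => x ^ 2), integral_pow,
    integral_pow]
  norm_num

/-- The number `4 * p 0` is the abscissa of the base-line point that projects orthogonally to `p`.
-/
lemma dist_sq_of_left {p : Plane} (hp : p 1 = √3 * p 0) (x : ℝ) :
    dist (basePoint x) p ^ 2 = 3 / 4 * x ^ 2 + 1 / 4 * (x - 4 * p 0) ^ 2 := by
  rw [dist_basePoint_sq, hp, mul_pow, Real.sq_sqrt (by norm_num)]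
  ring

lemma dist_sq_of_right {p : Plane} (hp : p 1 = -√3 * (p 0 - 2)) (x : ℝ) :
    dist (basePoint x) p ^ 2 =
      3 / 4 * (2 - x) ^ 2 + 1 / 4 * (x - (4 * p 0 - 6)) ^ 2 := by
  rw [dist_basePoint_sq, hp, mul_pow, neg_sq, Real.sq_sqrt (by norm_num)]
  ring

lemma exists_le_dist_sq {p : Plane} (hp : p ∈ sides) :
    ∃ c : ℝ, ∀ x ∈ Set.Icc (0 : ℝ) 2,
      3 / 4 * edgeDist x ^ 2 + 1 / 4 * (x - c) ^ 2 ≤ dist (basePoint x) p ^ 2 := by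
  have hm (x : ℝ) (hx : x ∈ Set.Icc (0 : ℝ) 2) : 0 ≤ edgeDist x :=
    le_min hx.1 (by linarith [hx.2])
  rcases hp with hp | hp
  · refine ⟨4 * p 0, fun x hx => ?_⟩
    rw [dist_sq_of_left hp.2.2]
    have := pow_le_pow_left₀ (hm x hx) (min_le_left x (2 - x)) 2
    linarith
  · refine ⟨4 * p 0 - 6, fun x hx => ?_⟩
    rw [dist_sq_of_right hp.2.2]
    have := pow_le_pow_left₀ (hm x hx) (min_le_right x (2 - x)) 2
    linarith

/-! ### Lower bound for every admissible set. -/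

lemma integral_sub_sq (a b c : ℝ) :
    ∫ x in a..b, (x - c) ^ 2 = ((b - c) ^ 3 - (a - c) ^ 3) / 3 := by
  rw [intervalIntegral.integral_comp_sub_right (fun x => x ^ 2), integral_pow]
  norm_num

/-- A truncated parabola, of total mass `4 r³ / 3`. -/
def bump (r c x : ℝ) : ℝ := max 0 (r ^ 2 - (x - c) ^ 2)

lemma continuous_bump (r c : ℝ) : Continuous (bump r c) := by
  unfold bump
  fun_prop

lemma integral_bump_le {r : ℝ} (hr : 0 ≤ r) (c : ℝ) {a b : ℝ} (hab : a ≤ b) :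
    ∫ x in a..b, bump r c x ≤ 4 / 3 * r ^ 3 := by
  -- The parabola is positive only within `r` of `c`; cutting it off there leaves a polynomial
  -- integral.
  set g : ℝ → ℝ := (Set.Ioc (c - r) (c + r)).indicator fun x => r ^ 2 - (x - c) ^ 2 with hg
  have hcont : Continuous fun x : ℝ => r ^ 2 - (x - c) ^ 2 := by fun_prop
  have hint : Integrable g := by
    rw [hg, integrable_indicator_iff measurableSet_Ioc]
    exact (hcont.integrableOn_Icc).mono_set Set.Ioc_subset_Icc_self
  have hnn : ∀ x, 0 ≤ g x := fun x => Set.indicator_nonneg (fun y hy => by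
    have := sq_le_sq' (a := y - c) (b := r) (by linarith [hy.1]) (by linarith [hy.2])
    linarith) x
  have hle : ∀ x, bump r c x ≤ g x := fun x => by
    refine max_le (hnn x) ?_
    by_cases hx : x ∈ Set.Ioc (c - r) (c + r)
    · rw [hg, Set.indicator_of_mem hx]
    · rw [hg, Set.indicator_of_notMem hx]
      have h : x ≤ c - r ∨ c + r < x := by
        by_contra! h
        exact hx h
      rcases h with h | h <;> nlinarith
  calc ∫ x in a..b, bump r c x ≤ ∫ x in a..b, g x :=
        intervalIntegral.integral_mono_on hab ((continuous_bump r c).intervalIntegrable a b)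
          hint.intervalIntegrable fun x _ => hle x
    _ ≤ ∫ x, g x := by
        rw [intervalIntegral.integral_of_le hab]
        exact setIntegral_le_integral hint (Filter.Eventually.of_forall hnn)
    _ = ∫ x in (c - r)..(c + r), (r ^ 2 - (x - c) ^ 2) := by
        rw [hg, integral_indicator measurableSet_Ioc,
          intervalIntegral.integral_of_le (by linarith)]
    _ = 4 / 3 * r ^ 3 := by
        rw [intervalIntegral.integral_sub (by simp)
          ((by fun_prop : Continuous fun x : ℝ => (x - c) ^ 2).intervalIntegrable _ _),
          integral_sub_sq]
        simp
        ring

/-- For every `a`, `(x - c a) ^ 2` is at least `r ^ 2` minus the sum of all bumps, since bumps are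
nonnegative. Integration needs only the number of bumps, not their positions. -/
theorem le_distortion {α : Set Plane} (hfin : α.Finite) (hne : α.Nonempty) (hα : α ⊆ sides)
    {r : ℝ} (hr : 0 ≤ r) :
    1 / 4 + 1 / 4 * r ^ 2 - 1 / 6 * α.ncard * r ^ 3 ≤ distortion uniformBase α := by
  have := hfin.fintype
  have := hne.to_subtype
  choose c hc using fun a : α => exists_le_dist_sq (hα a.2)
  have hb : Continuous fun x => ∑ a : α, bump r (c a) x :=
    continuous_finsetSum _ fun a _ => continuous_bump r (c a)
  have he := continuous_edgeDist
  have hpoint : ∀ x ∈ Set.Icc (0 : ℝ) 2,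
      3 / 4 * edgeDist x ^ 2 + (1 / 4 * r ^ 2 - 1 / 4 * ∑ a : α, bump r (c a) x) ≤
        ⨅ a : α, dist (basePoint x) (a : Plane) ^ 2 := fun x hx => by
    refine le_ciInf fun a => le_trans ?_ (hc a x hx)
    have h1 : bump r (c a) x ≤ ∑ a : α, bump r (c a) x :=
      Finset.single_le_sum (f := fun a => bump r (c a) x) (fun _ _ => le_max_left _ _)
        (Finset.mem_univ a)
    have h2 : r ^ 2 - (x - c a) ^ 2 ≤ bump r (c a) x := le_max_right _ _
    linarith
  have hmono := intervalIntegral.integral_mono_on (μ := volume) (by norm_num : (0 : ℝ) ≤ 2)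
    ((by fun_prop : Continuous fun x => 3 / 4 * edgeDist x ^ 2 +
      (1 / 4 * r ^ 2 - 1 / 4 * ∑ a : α, bump r (c a) x)).intervalIntegrable 0 2)
    (((continuous_iInf_dist_sq hfin hne).comp continuous_basePoint).intervalIntegrable 0 2)
    hpoint
  have hsum : ∫ x in (0 : ℝ)..2, ∑ a : α, bump r (c a) x ≤ α.ncard * (4 / 3 * r ^ 3) := by
    rw [intervalIntegral.integral_finsetSum fun a _ =>
      (continuous_bump r (c a)).intervalIntegrable _ _]
    refine (Finset.sum_le_card_nsmul _ _ _ fun a _ =>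
      integral_bump_le hr (c a) (by norm_num)).trans_eq ?_
    rw [nsmul_eq_mul, Finset.card_univ, ← Nat.card_eq_fintype_card, Nat.card_coe_set_eq]
  rw [intervalIntegral.integral_add
      ((by fun_prop : Continuous fun x => 3 / 4 * edgeDist x ^ 2).intervalIntegrable _ _)
      ((by fun_prop : Continuous fun x =>
        1 / 4 * r ^ 2 - 1 / 4 * ∑ a : α, bump r (c a) x).intervalIntegrable _ _),
    intervalIntegral.integral_sub (by simp)
      ((by fun_prop : Continuous fun x =>
        1 / 4 * ∑ a : α, bump r (c a) x).intervalIntegrable _ _),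
    intervalIntegral.integral_const, intervalIntegral.integral_const_mul,
    intervalIntegral.integral_const_mul, integral_edgeDist_sq, smul_eq_mul] at hmono
  rw [distortion_uniformBase hfin hne]
  simp only [Function.comp_def] at hmono
  linarith

lemma IsAdmissible.finite {S α : Set Plane} {n : ℕ} (h : IsAdmissible S n α) : α.Finite :=
  Set.finite_of_encard_le_coe h.2.2

lemma IsAdmissible.nonempty {S α : Set Plane} {n : ℕ} (h : IsAdmissible S n α) : α.Nonempty :=
  Set.one_le_encard_iff_nonempty.1 h.2.1

lemma IsAdmissible.le_distortion {k : ℕ} (hk : 0 < k) {α : Set Plane}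
    (h : IsAdmissible sides (2 * k) α) :
    1 / 48 * (12 + 1 / (k : ℝ) ^ 2) ≤ distortion uniformBase α := by
  have hk' : (0 : ℝ) < k := by exact_mod_cast hk
  have hcard : (α.ncard : ℝ) ≤ 2 * k := by
    have h1 := h.2.2
    rw [← h.finite.cast_ncard_eq] at h1
    exact_mod_cast h1
  -- This `r`, half a cell length, maximizes the bound for `2k` points.
  refine le_trans ?_ (ConstrainedQuantization.le_distortion h.finite h.nonempty h.1
    (r := 1 / (2 * k)) (by positivity))
  have h2 : (α.ncard : ℝ) * (1 / (2 * k)) ^ 3 ≤ 2 * k * (1 / (2 * k)) ^ 3 := by gcongr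
  have h3 : 1 / 48 * (12 + 1 / (k : ℝ) ^ 2) =
      1 / 4 + 1 / 4 * (1 / (2 * k)) ^ 2 - 1 / 6 * (2 * k * (1 / (2 * k : ℝ)) ^ 3) := by
    field_simp
    ring
  linarith

/-! ### The configuration attains the bound. -/

lemma spacingLeft_self {k : ℕ} (hk : 0 < k) : spacingLeft k k = 1 / (4 * k) := by
  have hk' : (0 : ℝ) < k := by exact_mod_cast hk
  unfold spacingLeft
  rw [Real.sqrt_mul_self (by positivity), mul_div_cancel_left₀ _ (by positivity)]
  congr 1
  ring

lemma spacingRight_self {k : ℕ} (hk : 0 < k) : spacingRight k k = 1 / (4 * k) := by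
  have hk' : (0 : ℝ) < k := by exact_mod_cast hk
  unfold spacingRight
  rw [Real.sqrt_mul_self (by positivity), mul_div_cancel_right₀ _ (by positivity)]
  congr 1
  ring

lemma odd_mul_spacing_mem {k i : ℕ} (hi : 1 ≤ i) (hik : i ≤ k) :
    (2 * (i : ℝ) - 1) * (1 / (4 * k)) / 2 ∈ Set.Icc (0 : ℝ) 1 := by
  have hi' : (1 : ℝ) ≤ i := by exact_mod_cast hi
  have hik' : (i : ℝ) ≤ k := by exact_mod_cast hik
  have hk' : (0 : ℝ) < k := by linarith
  refine ⟨by have : 0 ≤ 2 * (i : ℝ) - 1 := by linarith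
             positivity, ?_⟩
  rw [mul_one_div, div_div, div_le_one (by positivity)]
  linarith

lemma isAdmissible_configuration {k : ℕ} (hk : 0 < k) :
    IsAdmissible sides (2 * k) (configuration k k) := by
  refine ⟨?_, ?_, ?_⟩
  · rintro p (⟨i, hi, hik, rfl⟩ | ⟨j, hj, hjk, rfl⟩)
    · have := odd_mul_spacing_mem hi hik
      refine Or.inl ⟨?_, ?_, ?_⟩
      · simpa [leftAbscissa, spacingLeft_self hk] using this.1
      · simpa [leftAbscissa, spacingLeft_self hk] using this.2
      · simp [mul_comm]
    · have := odd_mul_spacing_mem hj hjk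
      rw [← spacingRight_self hk] at this
      refine Or.inr ⟨?_, ?_, ?_⟩
      · simp [rightAbscissa]
        linarith [this.2]
      · simp [rightAbscissa]
        linarith [this.1]
      · simp
        ring
  · exact Set.one_le_encard_iff_nonempty.2 ⟨_, Or.inl ⟨1, le_rfl, hk, rfl⟩⟩
  · have key (f : ℕ → Plane) : {p | ∃ i : ℕ, 1 ≤ i ∧ i ≤ k ∧ p = f i}.encard ≤ k := by
      have h : {p | ∃ i : ℕ, 1 ≤ i ∧ i ≤ k ∧ p = f i} = f '' (Finset.Icc 1 k : Finset ℕ) := by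
        ext p
        simp [and_assoc, eq_comm]
      rw [h]
      refine (Set.encard_image_le _ _).trans ?_
      rw [Set.encard_coe_eq_coe_finsetCard]
      simp
    refine (Set.encard_union_le _ _).trans ?_
    rw [Nat.cast_mul, Nat.cast_ofNat, two_mul]
    exact add_le_add (key _) (key _)

/-- Each of the `2k` cells of length `1 / k` of the base is served by a point of the
configuration whose foot is the midpoint of the cell. -/
lemma exists_mem_configuration {k : ℕ} (hk : 0 < k) {i : ℕ} (hi : i < 2 * k) :
    ∃ p ∈ configuration k k, ∀ x ∈ Set.Icc ((i : ℝ) / k) ((i + 1 : ℕ) / k),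
      dist (basePoint x) p ^ 2 =
        3 / 4 * edgeDist x ^ 2 + 1 / 4 * (x - (2 * i + 1) / (2 * k)) ^ 2 := by
  have hk' : (0 : ℝ) < k := by exact_mod_cast hk
  rcases lt_or_ge i k with h | h
  · refine ⟨_, Or.inl ⟨i + 1, by omega, h, rfl⟩, fun x hx => ?_⟩
    have hx1 : x ≤ 1 := hx.2.trans ((div_le_one hk').2 (by exact_mod_cast h))
    rw [dist_sq_of_left (by simp [mul_comm]), edgeDist, min_eq_left (by linarith)]
    congr 4
    simp only [leftAbscissa, spacingLeft_self hk, Matrix.cons_val_zero]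
    push_cast
    field_simp
    ring
  -- Cells are counted from `0` at the left end, right-hand points from `1` at the right end.
  · refine ⟨_, Or.inr ⟨2 * k - i, by omega, by omega, rfl⟩, fun x hx => ?_⟩
    have hx1 : 1 ≤ x := ((one_le_div hk').2 (by exact_mod_cast h)).trans hx.1
    rw [dist_sq_of_right (by simp; ring), edgeDist, min_eq_right (by linarith)]
    congr 4
    simp only [rightAbscissa, spacingRight_self hk, Matrix.cons_val_zero]
    rw [Nat.cast_sub hi.le]
    push_cast
    field_simp
    ring

/-- No Voronoi regions are needed: on each cell the infimum is at most the distance to one chosen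
point. -/
lemma distortion_configuration_le {k : ℕ} (hk : 0 < k) :
    distortion uniformBase (configuration k k) ≤ 1 / 48 * (12 + 1 / (k : ℝ) ^ 2) := by
  have hk' : (0 : ℝ) < k := by exact_mod_cast hk
  have hadm := isAdmissible_configuration hk
  have hF : Continuous fun x => ⨅ a : configuration k k, dist (basePoint x) (a : Plane) ^ 2 :=
    (continuous_iInf_dist_sq hadm.finite hadm.nonempty).comp continuous_basePoint
  have he := continuous_edgeDist
  rw [distortion_uniformBase hadm.finite hadm.nonempty]
  set F : ℝ → ℝ := fun x => ⨅ a : configuration k k, dist (basePoint x) (a : Plane) ^ 2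
  have hG : Continuous fun x => F x - 3 / 4 * edgeDist x ^ 2 := by fun_prop
  have hcell : ∀ i ∈ Finset.range (2 * k),
      ∫ x in ((i : ℝ) / k)..((i + 1 : ℕ) / k), (F x - 3 / 4 * edgeDist x ^ 2) ≤
        1 / (48 * (k : ℝ) ^ 3) := fun i hi => by
    obtain ⟨p, hp, hpx⟩ := exists_mem_configuration hk (Finset.mem_range.1 hi)
    have hle : (i : ℝ) / k ≤ (i + 1 : ℕ) / k := by gcongr; simp
    calc _ ≤ ∫ x in ((i : ℝ) / k)..((i + 1 : ℕ) / k),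
          1 / 4 * (x - (2 * i + 1) / (2 * k)) ^ 2 := by
          refine intervalIntegral.integral_mono_on hle (hG.intervalIntegrable _ _)
            (Continuous.intervalIntegrable (by fun_prop) _ _) fun x hx => ?_
          have h1 : F x ≤ dist (basePoint x) p ^ 2 :=
            ciInf_le (f := fun a : configuration k k => dist (basePoint x) (a : Plane) ^ 2)
              ⟨0, by rintro _ ⟨a, rfl⟩; positivity⟩ ⟨p, hp⟩
          rw [hpx x hx] at h1
          linarith
      _ = 1 / (48 * (k : ℝ) ^ 3) := by
          rw [intervalIntegral.integral_const_mul, integral_sub_sq]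
          push_cast
          field_simp
          ring
  have htotal : ∫ x in (0 : ℝ)..2, (F x - 3 / 4 * edgeDist x ^ 2) ≤
      1 / (24 * (k : ℝ) ^ 2) := by
    have h := intervalIntegral.sum_integral_adjacent_intervals (μ := volume) (n := 2 * k)
      (a := fun i : ℕ => (i : ℝ) / k) (fun i _ => hG.intervalIntegrable _ _)
    have h2 : ((2 * k : ℕ) : ℝ) / k = 2 := by
      push_cast
      field_simp
    rw [h2, Nat.cast_zero, zero_div] at h
    rw [← h]
    refine (Finset.sum_le_card_nsmul _ _ _ hcell).trans_eq ?_
    rw [Finset.card_range, nsmul_eq_mul]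
    push_cast
    field_simp
    norm_num
  rw [intervalIntegral.integral_sub (hF.intervalIntegrable _ _)
    (Continuous.intervalIntegrable (by fun_prop) _ _), intervalIntegral.integral_const_mul,
    integral_edgeDist_sq] at htotal
  have h3 : 1 / 48 * (12 + 1 / (k : ℝ) ^ 2) = 1 / 2 * (1 / (24 * (k : ℝ) ^ 2) + 1 / 2) := by
    field_simp
    ring
  linarith

end ConstrainedQuantization

theorem corollary3p2 (n k : ℕ) (hk : 3 ≤ k) (hn : n = 2 * k) :
    ConstrainedQuantization.IsOptimalSet ConstrainedQuantization.uniformBase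
        ConstrainedQuantization.sides n (ConstrainedQuantization.configuration k k) ∧
      ConstrainedQuantization.quantizationError ConstrainedQuantization.uniformBase
        ConstrainedQuantization.sides n = 1 / 48 * (12 + 1 / (k : ℝ) ^ 2) := by
  open ConstrainedQuantization in
  subst hn
  have hk0 : 0 < k := by omega
  have hadm := isAdmissible_configuration hk0
  have heq : distortion uniformBase (configuration k k) = 1 / 48 * (12 + 1 / (k : ℝ) ^ 2) :=
    le_antisymm (distortion_configuration_le hk0)
      (IsAdmissible.le_distortion hk0 (by exact_mod_cast hadm))
  have hV : quantizationError uniformBase sides (2 * k) = 1 / 48 * (12 + 1 / (k : ℝ) ^ 2) := by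
    refine IsLeast.csInf_eq ⟨⟨_, hadm, heq.symm⟩, ?_⟩
    rintro _ ⟨α, hα, rfl⟩
    exact IsAdmissible.le_distortion hk0 hα
  exact ⟨⟨hadm, heq.trans hV.symm⟩, hV⟩
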